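/- For a formal power series $f=\sum_{v\ge 0}a_vz^v$, identified with its coefficient sequence $(a_v)\in\mathbb{C}^{\mathbb{N}_0}$, put $a_k=0$ for $k<0$. For $p,q\in\mathbb{N}_0$ write $f\in\mathfrak{D}_{p,q}$ if the Hankel determinant $\det\left(a_{p-q+1+i+j}\right)_{0\le i,j\le q-1}$ is nonzero (it is $1$ if $q=0$). In that case there is exactly one pair of polynomials $A(z)=\sum_{v=0}^{p}n_vz^v$, $B(z)=\sum_{v=0}^{q}d_vz^v$ with $d_0=1$ such that the Taylor series of $A/B$ at $0$ agrees with $f$ in the terms of index $0,1,\dots,p+q$; moreover $A$ and $B$ are coprime. The rational function $[p/q]_f:=A/B$ is the Padé approximant of type $(p,q)$ of $f$; call it exact if in addition $n_pd_q\neq0$. Let $\mathfrak{J}\subset\mathbb{N}_0\times\mathbb{N}_0$ satisfy condition $(\widetilde{\mathcal H})$: it contains a sequence $(p_n,q_n)_{n\ge1}$ with $\lim_n q_n=\lim_n(p_n-q_n)=+\infty$. Let $(K_m)_{m\ge1}$ be a sequence of compact subsets of $\mathbb{C}\setminus\{0\}$. **Proposition 4.4.** Let $\widetilde{\mathcal U}$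 be the set of all $f\in\mathbb{C}^{\mathbb{N}_0}$ such that for every $m$ and every function $Q$ holomorphic in a neighborhood of $K_m$ there is a sequence $(\tilde p_n,\tilde q_n)_{n\ge1}$ in $\mathfrak{J}$ such that $f\in\mathfrak{D}_{\tilde p_n,\tilde q_n}$ and $[\tilde p_n/\tilde q_n]_f$ has no poles on $K_m$ for all $n$, and $[\tilde p_n/\tilde q_n]_f\to Q$ uniformly on $K_m$ as $n\to\infty$. Then $\widetilde{\mathcal U}$ is dense and $G_\delta$ in $\mathbb{C}^{\mathbb{N}_0}$ with the product topology. The same holds for the class defined in the same way with the additional requirement that all the approximants $[\tilde p_n/\tilde q_n]_f$ be exact. -/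

import Mathlib

namespace PadeUniversal

/-- The coefficient of index `k` of the formal power series with coefficients `a`, for an
arbitrary integer `k`; it is `0` for negative `k`. -/
noncomputable def intCoeff (a : ℕ → ℂ) (k : ℤ) : ℂ :=
  if k < 0 then 0 else a k.toNat

/-- The Hankel matrix of order `q` at `a_{p-q+1}`: the `q × q` matrix whose `(i, j)` entry is
`a_{p-q+1+i+j}` for `0 ≤ i, j < q`. -/
noncomputable def hankel (a : ℕ → ℂ) (p q : ℕ) : Matrix (Fin q) (Fin q) ℂ :=
  Matrix.of fun i j =>
    intCoeff a ((p : ℤ) - (q : ℤ) + 1 + ((i : ℕ) : ℤ) + ((j : ℕ) : ℤ))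

/-- The set `𝔇_{p,q}` of formal power series (given by their coefficients) whose Hankel determinant
of order `q` at `a_{p-q+1}` does not vanish; for `q = 0` the empty determinant is `1`. -/
def padeRegular (p q : ℕ) : Set (ℕ → ℂ) :=
  {a | (hankel a p q).det ≠ 0}

/-- The quotient `A / B` is a Padé approximant of type `(p, q)` of the formal power series
`∑ a_v z^v`: `deg A ≤ p`, `deg B ≤ q`, `B(0) = 1`, and the Taylor series of `A / B` at `0` agrees
with `∑ a_v z^v` in the terms of index `0, …, p + q`. For `a ∈ 𝔇_{p,q}` there is exactly one such
pair `(A, B)`, and it is coprime, so that the zeros of `B` are the poles of `A / B`. -/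
def IsPadeApproximant (a : ℕ → ℂ) (p q : ℕ) (A B : Polynomial ℂ) : Prop :=
  A.natDegree ≤ p ∧ B.natDegree ≤ q ∧ B.coeff 0 = 1 ∧
    ∀ v : ℕ, v ≤ p + q →
      PowerSeries.coeff v ((A : PowerSeries ℂ) * (B : PowerSeries ℂ)⁻¹) = a v

/-- A Padé approximant of type `(p, q)` whose numerator and denominator have degrees exactly `p`
and `q`, that is, `n_p d_q ≠ 0` for the coefficients. -/
def IsExactPadeApproximant (a : ℕ → ℂ) (p q : ℕ) (A B : Polynomial ℂ) : Prop :=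
  IsPadeApproximant a p q A B ∧ A.coeff p * B.coeff q ≠ 0

/-- Condition `(H̃)` on a set of indices: it contains a sequence `(p_n, q_n)` such that
`q_n → +∞` and `p_n - q_n → +∞`. -/
def ConditionH (J : Set (ℕ × ℕ)) : Prop :=
  ∃ p q : ℕ → ℕ, (∀ n, (p n, q n) ∈ J) ∧
    Filter.Tendsto q Filter.atTop Filter.atTop ∧
    Filter.Tendsto (fun n => (p n : ℤ) - (q n : ℤ)) Filter.atTop Filter.atTop

/-- `Q` is holomorphic in a neighborhood of `K`. -/
def HolomorphicNear (Q : ℂ → ℂ) (K : Set ℂ) : Prop :=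
  ∃ U : Set ℂ, IsOpen U ∧ K ⊆ U ∧ DifferentiableOn ℂ Q U

/-- There is a sequence `(p_n, q_n)` in `J` such that `a ∈ 𝔇_{p_n,q_n}` for all `n` and the Padé
approximants `[p_n / q_n]` of `a` have no poles on `K` and converge to `Q` uniformly on `K`. The
relation `IsApprox` says which quotients count as Padé approximants. -/
def IsUniformPadeLimit
    (IsApprox : (ℕ → ℂ) → ℕ → ℕ → Polynomial ℂ → Polynomial ℂ → Prop)
    (J : Set (ℕ × ℕ)) (K : Set ℂ) (a : ℕ → ℂ) (Q : ℂ → ℂ) : Prop :=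
  ∃ (p q : ℕ → ℕ) (A B : ℕ → Polynomial ℂ),
    (∀ n, (p n, q n) ∈ J) ∧
    (∀ n, a ∈ padeRegular (p n) (q n)) ∧
    (∀ n, IsApprox a (p n) (q n) (A n) (B n)) ∧
    (∀ n, ∀ z ∈ K, (B n).eval z ≠ 0) ∧
    TendstoUniformlyOn (fun n z => (A n).eval z / (B n).eval z) Q Filter.atTop K

/-- The class `Ũ` of formal power series such that, for every `m`, every function holomorphic in a
neighborhood of `K m` is a uniform limit on `K m` of Padé approximants with indices in `J`. -/
def universalClass
    (IsApprox : (ℕ → ℂ) → ℕ → ℕ → Polynomial ℂ → Polynomial ℂ → Prop)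
    (J : Set (ℕ × ℕ)) (K : ℕ → Set ℂ) : Set (ℕ → ℂ) :=
  {a | ∀ (m : ℕ) (Q : ℂ → ℂ), HolomorphicNear Q (K m) → IsUniformPadeLimit IsApprox J (K m) a Q}

end PadeUniversal

open MeasureTheory Set Filter Topology Polynomial
open scoped Manifold

namespace PadeUniversal


/-! This is a Baire category argument. Uniform approximability of `Q` on `K m` is tested on
countably many `Q` (since `C(K m, ℂ)` is separable metric, so is the set of restrictions of
holomorphic functions) and on tolerances `1/(l+1)`, so the class is a countable intersection of sets
`approximable`. Each is open and dense, and `ℕ → ℂ` is a Baire space.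

Open: on `padeRegular p q` the approximant is unique and given by Cramer's rule, so its coefficients
depend continuously on finitely many `a v`; compactness of `K m` makes absence of poles, closeness
to `Q` and nonvanishing of leading coefficients stable.

Dense: a neighborhood in the product topology controls finitely many coefficients. Runge's theorem,
applied to `(Q - P) / z ^ N`, gives a rational function with these Taylor coefficients that is close
to `Q` on `K m`; it applies because `0 ∉ K m`. A small perturbation gives it degrees exactly `(p, q)
∈ J` and lowest terms; condition (H̃) leaves room for this. The Taylor series of the result is its
own exact Padé source, and coprimality forces the Hankel determinant to be nonzero. -/

/-! ### The Cauchy–Pompeiu formula. -/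

/-- The Wirtinger derivative `∂f/∂z̄`. -/
noncomputable def dbar (f : ℂ → ℂ) (z : ℂ) : ℂ :=
  (fderiv ℝ f z 1 + Complex.I * fderiv ℝ f z Complex.I) / 2

lemma continuous_dbar {f : ℂ → ℂ} (hf : ContDiff ℝ 1 f) : Continuous (dbar f) := by
  have h := hf.continuous_fderiv one_ne_zero
  unfold dbar
  fun_prop

lemma integrableOn_polar_of_continuous {G : ℝ × ℝ → ℂ} (hG : Continuous G) {R : ℝ}
    (hR : ∀ r θ, R < r → G (r, θ) = 0) :
    IntegrableOn G (Ioi 0 ×ˢ Ioo (-Real.pi) Real.pi) := by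
  have h1 : IntegrableOn G (Icc 0 R ×ˢ Icc (-Real.pi) Real.pi) :=
    hG.continuousOn.integrableOn_compact (isCompact_Icc.prod isCompact_Icc)
  refine (h1.of_forall_sdiff_eq_zero (t := Ioi 0 ×ˢ Ioo (-Real.pi) Real.pi)
    (measurableSet_Ioi.prod measurableSet_Ioo) ?_)
  rintro ⟨r, θ⟩ ⟨⟨hr, hθ⟩, h⟩
  apply hR
  by_contra! hle
  exact h ⟨⟨le_of_lt hr, hle⟩, Ioo_subset_Icc_self hθ⟩

/-- The Cauchy–Pompeiu formula at the origin for compactly supported `C¹` functions. -/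
lemma integral_dbar_div {f : ℂ → ℂ} (hf : ContDiff ℝ 1 f) (hs : HasCompactSupport f) :
    ∫ z, dbar f z / z = -(Real.pi * f 0) := by
  obtain ⟨R, hR⟩ := hs.isCompact.isBounded.subset_closedBall 0
  have hR0 : ∀ z : ℂ, R < ‖z‖ → z ∉ tsupport f := fun z hz h => by
    have := hR h
    simp at this
    linarith
  let u : ℝ → ℂ := fun θ => Complex.exp (θ * Complex.I)
  have hu : Continuous u := by fun_prop
  have hnu : ∀ θ, ‖u θ‖ = 1 := fun θ => Complex.norm_exp_ofReal_mul_I θ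
  have hdu : ∀ θ, HasDerivAt u (Complex.I * u θ) θ := fun θ => by
    have := ((Complex.ofRealCLM.hasDerivAt (x := θ)).mul_const Complex.I).cexp
    simpa [u, mul_comm] using this
  have hD := hf.continuous_fderiv one_ne_zero
  have hdf : ∀ z, HasFDerivAt f (fderiv ℝ f z) z := fun z =>
    (hf.differentiable one_ne_zero z).hasFDerivAt
  let G₁ : ℝ × ℝ → ℂ := fun p => fderiv ℝ f (p.1 * u p.2) (u p.2)
  let G₂ : ℝ × ℝ → ℂ := fun p => fderiv ℝ f (p.1 * u p.2) (Complex.I * u p.2)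
  have hfd : ∀ z : ℂ, R < ‖z‖ → fderiv ℝ f z = 0 := fun z hz =>
    image_eq_zero_of_notMem_tsupport fun h => hR0 z hz (tsupport_fderiv_subset ℝ h)
  have hnorm : ∀ r θ : ℝ, R < r → R < ‖(r : ℂ) * u θ‖ := fun r θ h => by
    rw [norm_mul, hnu, mul_one, Complex.norm_real]
    exact h.trans_le (le_abs_self r)
  have hG₁ : IntegrableOn G₁ (Ioi 0 ×ˢ Ioo (-Real.pi) Real.pi) := by
    refine integrableOn_polar_of_continuous (R := R) (by fun_prop) fun r θ h => ?_
    simp [G₁, hfd _ (hnorm r θ h)]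
  have hG₂ : IntegrableOn G₂ (Ioi 0 ×ˢ Ioo (-Real.pi) Real.pi) := by
    refine integrableOn_polar_of_continuous (R := R) (by fun_prop) fun r θ h => ?_
    simp [G₂, hfd _ (hnorm r θ h)]
  -- Along each ray `G₁` is the radial derivative of `f`, so the inner integral is `-f 0`; the angle
  -- contributes `2π`.
  have e₁ : ∫ p in Ioi 0 ×ˢ Ioo (-Real.pi) Real.pi, G₁ p = -(2 * Real.pi * f 0) := by
    rw [Measure.volume_eq_prod] at hG₁ ⊢
    rw [← setIntegral_prod_swap, setIntegral_prod (fun z => G₁ z.swap) hG₁.swap]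
    have : ∀ θ : ℝ, ∫ r in Ioi (0 : ℝ), G₁ (r, θ) = - f 0 := fun θ => by
      have hd : ∀ r ∈ Ici (0 : ℝ), HasDerivAt (fun r : ℝ => f (r * u θ)) (G₁ (r, θ)) r := by
        intro r _
        have h1 : HasDerivAt (fun r : ℝ => (r : ℂ) * u θ) (u θ) r := by
          simpa using (Complex.ofRealCLM.hasDerivAt (x := r)).mul_const (u θ)
        exact (hdf _).comp_hasDerivAt r h1
      have hc : Continuous fun r : ℝ => G₁ (r, θ) := by fun_prop
      have hi : IntegrableOn (fun r : ℝ => G₁ (r, θ)) (Ioi 0) := by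
        refine (hc.continuousOn.integrableOn_compact
          (isCompact_Icc (a := 0) (b := R))).of_forall_sdiff_eq_zero measurableSet_Ioi ?_
        rintro r ⟨hr, h⟩
        have : R < r := by
          by_contra! hle
          exact h ⟨le_of_lt hr, hle⟩
        simp [G₁, hfd _ (hnorm r θ this)]
      have ht : Tendsto (fun r : ℝ => f (r * u θ)) atTop (𝓝 0) := by
        refine tendsto_const_nhds.congr' ?_
        filter_upwards [eventually_gt_atTop R] with r hr
        exact (image_eq_zero_of_notMem_tsupport (hR0 _ (hnorm r θ hr))).symm
      simpa using integral_Ioi_of_hasDerivAt_of_tendsto' hd hi ht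
    simp only [Prod.swap_prod_mk, this]
    rw [setIntegral_const, Measure.real, Real.volume_Ioo, ENNReal.toReal_ofReal (by linarith [Real.pi_pos]),
      Complex.real_smul]
    push_cast
    ring
  -- On each circle `G₂` is the angular derivative of `f / r`, whose integral over a period is zero.
  have e₂ : ∫ p in Ioi 0 ×ˢ Ioo (-Real.pi) Real.pi, G₂ p = 0 := by
    rw [Measure.volume_eq_prod] at hG₂ ⊢
    rw [setIntegral_prod _ hG₂]
    refine setIntegral_eq_zero_of_forall_eq_zero fun r hr => ?_
    have hr' : (r : ℂ) ≠ 0 := by exact_mod_cast (ne_of_gt hr)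
    have hd : ∀ θ ∈ uIcc (-Real.pi) Real.pi,
        HasDerivAt (fun θ : ℝ => (r : ℂ)⁻¹ * f (r * u θ)) (G₂ (r, θ)) θ := by
      intro θ _
      have h1 : HasDerivAt (fun θ : ℝ => (r : ℂ) * u θ) (r * (Complex.I * u θ)) θ :=
        (hdu θ).const_mul _
      have h2 := ((hdf _).comp_hasDerivAt θ h1).const_mul (r : ℂ)⁻¹
      have h3 : (r : ℂ) * (Complex.I * u θ) = r • (Complex.I * u θ) := by simp
      rw [h3, map_smul, Complex.real_smul, inv_mul_cancel_left₀ hr'] at h2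
      exact h2
    rw [← integral_Ioc_eq_integral_Ioo, ← intervalIntegral.integral_of_le
      (by linarith [Real.pi_pos]), intervalIntegral.integral_eq_sub_of_hasDerivAt hd]
    · simp [u, Complex.exp_neg]
    · have hc : Continuous fun θ : ℝ => G₂ (r, θ) := by fun_prop
      exact hc.intervalIntegrable _ _
  rw [← Complex.integral_comp_polarCoord_symm, polarCoord_target]
  -- Polar form of `∂/∂z̄`: for `|u| = 1`, `Df(u) + i Df(iu) = 2 (∂f/∂z̄) / u`, and the Jacobian `r`
  -- cancels against `z = r u`.
  have key : ∀ p ∈ Ioi (0 : ℝ) ×ˢ Ioo (-Real.pi) Real.pi,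
      p.1 • (dbar f (Complex.polarCoord.symm p) / Complex.polarCoord.symm p) =
        (1 / 2 : ℂ) * (G₁ p + Complex.I * G₂ p) := by
    rintro ⟨r, θ⟩ ⟨hr, -⟩
    have hr' : (r : ℂ) ≠ 0 := by exact_mod_cast (ne_of_gt hr)
    have hpc : Complex.polarCoord.symm (r, θ) = r * u θ := by
      rw [Complex.polarCoord_symm_apply]
      simp [u, Complex.exp_mul_I]
    have hu' : u θ = Real.cos θ • (1 : ℂ) + Real.sin θ • Complex.I := by
      simp [u, Complex.exp_mul_I]
    have hiu' : Complex.I * u θ = (-Real.sin θ) • (1 : ℂ) + Real.cos θ • Complex.I := by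
      rw [hu']
      simp only [Complex.real_smul]
      push_cast
      linear_combination (Complex.sin θ) * Complex.I_mul_I
    have hcs : (Complex.cos θ) ^ 2 + (Complex.sin θ) ^ 2 = 1 := Complex.cos_sq_add_sin_sq _
    have hu0 : u θ ≠ 0 := Complex.exp_ne_zero _
    have hui : (u θ)⁻¹ = Complex.cos θ - Complex.sin θ * Complex.I := by
      rw [inv_eq_iff_eq_inv, eq_comm, inv_eq_iff_eq_inv, eq_comm]
      rw [inv_eq_of_mul_eq_one_left]
      rw [hu']
      simp only [Complex.real_smul]
      push_cast
      linear_combination hcs - (Complex.sin θ)^2 * Complex.I_sq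
    have : (r : ℝ) • (dbar f (r * u θ) / (r * u θ)) = dbar f (r * u θ) * (u θ)⁻¹ := by
      rw [Complex.real_smul]
      field_simp
    simp only [hpc, this, hui, G₁, G₂]
    rw [hiu', hu', map_add, map_add, map_smul, map_smul, map_smul, map_smul, ← hu']
    simp only [Complex.real_smul, dbar]
    push_cast
    linear_combination (- Complex.sin θ * (fderiv ℝ f (r * u θ)) Complex.I / 2) * Complex.I_mul_I
  rw [setIntegral_congr_fun (measurableSet_Ioi.prod measurableSet_Ioo) key,
    integral_const_mul, integral_add hG₁ (hG₂.const_mul _), integral_const_mul, e₁, e₂]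
  ring

/-- The Cauchy–Pompeiu formula for compactly supported `C¹` functions. -/
lemma integral_dbar_div_sub {f : ℂ → ℂ} (hf : ContDiff ℝ 1 f) (hs : HasCompactSupport f) (z : ℂ) :
    ∫ w, dbar f w / (w - z) = -(Real.pi * f z) := by
  have h := integral_dbar_div (f := fun w => f (w + z)) (by fun_prop)
    (hs.comp_homeomorph (Homeomorph.addRight z))
  simp only [zero_add] at h
  rw [← h, ← integral_add_right_eq_self _ z]
  simp [dbar, fderiv_comp_add_right]


/-! ### Runge's theorem by the Cauchy transform. -/

/-- The continuous functions on `K` that are given by a quotient of polynomials whose denominator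
has constant coefficient `1` and no zeros on `K`. -/
def rationalFunctions (K : Set ℂ) : Submodule ℂ C(K, ℂ) where
  carrier := {g | ∃ A B : ℂ[X], B.coeff 0 = 1 ∧ (∀ z ∈ K, B.eval z ≠ 0) ∧
    ∀ z : K, g z = A.eval (z : ℂ) / B.eval (z : ℂ)}
  add_mem' := by
    rintro g h ⟨A, B, hB, hBK, hg⟩ ⟨A', B', hB', hBK', hh⟩
    refine ⟨A * B' + A' * B, B * B', by simp [mul_coeff_zero, hB, hB'],
      fun z hz => by simpa using ⟨hBK z hz, hBK' z hz⟩, fun z => ?_⟩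
    have h1 := hBK z z.2
    have h2 := hBK' z z.2
    simp only [ContinuousMap.add_apply, hg, hh, eval_add, eval_mul]
    field_simp
  zero_mem' := ⟨0, 1, by simp, by simp, by simp⟩
  smul_mem' := by
    rintro c g ⟨A, B, hB, hBK, hg⟩
    exact ⟨C c * A, B, hB, hBK, fun z => by simp [hg, mul_div_assoc]⟩

/-- A closed subspace is complete, so the integral can be formed inside `M` and carried over by the
inclusion. -/
lemma integral_mem_of_isClosed {E : Type*} [NormedAddCommGroup E] [NormedSpace ℂ E]
    [CompleteSpace E] (M : Submodule ℂ E) (hM : IsClosed (M : Set E)) {F : ℂ → E}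
    (hF : Continuous F) (hs : HasCompactSupport F) (h : ∀ z, F z ∈ M) : ∫ z, F z ∈ M := by
  have : CompleteSpace M := hM.completeSpace_coe
  let F' : ℂ → M := fun z => ⟨F z, h z⟩
  have hs' : HasCompactSupport F' := by
    refine hs.mono fun z hz => ?_
    simpa [F'] using hz
  have hi : Integrable F' := (hF.subtype_mk h).integrable_of_hasCompactSupport hs'
  have := M.subtypeL.integral_comp_comm hi
  change ∫ z, F z = _ at this
  rw [this]
  exact Subtype.mem _

/-- A function holomorphic near a compact set `K` agrees near `K` with a `C¹` function with compact
support in a prescribed neighborhood. -/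
lemma exists_contDiff_extension {K U : Set ℂ} (hK : IsCompact K) (hU : IsOpen U) (hKU : K ⊆ U)
    {Q : ℂ → ℂ} (hQ : DifferentiableOn ℂ Q U) :
    ∃ f : ℂ → ℂ, ContDiff ℝ 1 f ∧ HasCompactSupport f ∧ tsupport f ⊆ U ∧ f =ᶠ[𝓝ˢ K] Q := by
  obtain ⟨t, ht, hKt, htU⟩ := exists_compact_between hK hU hKU
  obtain ⟨φ, hφ1, hφ0, -⟩ := exists_contMDiffMap_one_nhds_of_subset_interior
    (n := 1) (I := 𝓘(ℝ, ℂ)) hK.isClosed hKt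
  have hφ : ContDiff ℝ 1 φ := by exact_mod_cast φ.contMDiff.contDiff
  have hsub : tsupport (fun z => (φ z : ℂ) * Q z) ⊆ t := by
    refine closure_minimal (fun z hz => ?_) ht.isClosed
    by_contra h
    exact hz (by simp [hφ0 z h])
  refine ⟨fun z => φ z * Q z, ?_, HasCompactSupport.of_support_subset_isCompact ht
    ((subset_tsupport _).trans hsub), hsub.trans htU, ?_⟩
  · rw [contDiff_iff_contDiffAt]
    intro z
    by_cases hz : z ∈ U
    · have h1 : ContDiffAt ℂ 1 Q z := (hQ.contDiffOn hU).contDiffAt (hU.mem_nhds hz)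
      exact (Complex.ofRealCLM.contDiff.contDiffAt.comp z hφ.contDiffAt).mul (h1.restrict_scalars ℝ)
    · refine (contDiffAt_const (c := (0 : ℂ))).congr_of_eventuallyEq ?_
      filter_upwards [ht.isClosed.isOpen_compl.mem_nhds fun h => hz (htU h)] with w hw
      simp [hφ0 w hw]
  · filter_upwards [hφ1] with z hz
    simp [hz]

/-- These are the Cauchy–Riemann equations. -/
lemma dbar_eq_zero {f Q : ℂ → ℂ} {z : ℂ} (hfQ : f =ᶠ[𝓝 z] Q) (hQ : DifferentiableAt ℂ Q z) :
    dbar f z = 0 := by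
  have h : fderiv ℝ f z = (fderiv ℂ Q z).restrictScalars ℝ := by
    rw [hfQ.fderiv_eq]
    exact (hQ.hasFDerivAt.restrictScalars ℝ).fderiv
  have h2 : fderiv ℂ Q z Complex.I = Complex.I * fderiv ℂ Q z 1 := by
    rw [← smul_eq_mul, ← map_smul, smul_eq_mul, mul_one]
  simp only [dbar, h, ContinuousLinearMap.coe_restrictScalars', h2]
  linear_combination (fderiv ℂ Q z 1) / 2 * Complex.I_mul_I

lemma tsupport_dbar_subset (f : ℂ → ℂ) : tsupport (dbar f) ⊆ tsupport f := by
  refine closure_minimal (fun z hz => ?_) (isClosed_tsupport f)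
  by_contra h
  have : fderiv ℝ f z = 0 :=
    image_eq_zero_of_notMem_tsupport fun h' => h (tsupport_fderiv_subset ℝ h')
  exact hz (by simp [dbar, this])

/-- **Runge's theorem** for a compact set that does not contain `0`: the approximating rational
functions may be taken with poles off `K ∪ {0}`. -/
theorem exists_rational_approx {K : Set ℂ} (hK : IsCompact K) (hK0 : (0 : ℂ) ∉ K) {Q : ℂ → ℂ}
    (hQ : HolomorphicNear Q K) {ε : ℝ} (hε : 0 < ε) :
    ∃ A B : ℂ[X], B.coeff 0 = 1 ∧ (∀ z ∈ K, B.eval z ≠ 0) ∧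
      ∀ z ∈ K, ‖A.eval z / B.eval z - Q z‖ < ε := by
  obtain ⟨U, hU, hKU, hQU⟩ := hQ
  -- Removing `0` from `U` keeps the support of `f`, hence all poles `w` below, away from `0`; this
  -- allows denominators with constant term `1`.
  obtain ⟨f, hf, hfc, hfU, hfQ⟩ := exists_contDiff_extension hK
    (hU.inter isOpen_compl_singleton) (fun z hz => ⟨hKU hz, fun h => hK0 ((show z = 0 from h) ▸ hz)⟩)
    (hQU.mono (inter_subset_left (t := {0}ᶜ)))
  have : CompactSpace K := isCompact_iff_compactSpace.mp hK
  have hfK : ∀ z ∈ K, f =ᶠ[𝓝 z] Q := fun z hz => hfQ.filter_mono (nhds_le_nhdsSet hz)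
  have hh := continuous_dbar hf
  have hK' : ∀ z ∈ K, dbar f =ᶠ[𝓝 z] 0 := fun z hz => by
    filter_upwards [(hfK z hz).eventuallyEq_nhds, hU.mem_nhds (hKU hz)] with w hw hwU
    exact dbar_eq_zero hw (hQU.differentiableAt (hU.mem_nhds hwU))
  -- The kernel is continuous even on the diagonal, because `dbar f` vanishes near every point of
  -- `K`.
  have hjoint : Continuous fun p : ℂ × K => dbar f p.1 / (p.1 - p.2) := by
    rw [continuous_iff_continuousAt]
    rintro ⟨w, z⟩
    by_cases hwz : w = z
    · refine (continuousAt_const (y := (0 : ℂ))).congr ?_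
      have h1 : ∀ᶠ v in 𝓝 w, dbar f v = 0 := hwz ▸ hK' z z.2
      have := (continuousAt_fst (p := (w, z))).eventually h1
      filter_upwards [this] with p hp
      simp [hp]
    · refine ContinuousAt.div (by fun_prop) (by fun_prop) ?_
      simpa [sub_eq_zero] using hwz
  let F : C(ℂ, C(K, ℂ)) := ContinuousMap.curry ⟨_, hjoint⟩
  have hFapp : ∀ w (z : K), F w z = dbar f w / (w - z) := fun w z => rfl
  have hFs : HasCompactSupport F := by
    refine HasCompactSupport.of_support_subset_isCompact hfc fun w hw => ?_
    refine tsupport_dbar_subset f (subset_tsupport _ fun h => hw ?_)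
    ext z
    simp [hFapp, h]
  have hFmem : ∀ w, F w ∈ (rationalFunctions K).topologicalClosure := fun w => by
    refine Submodule.le_topologicalClosure _ ?_
    by_cases hw : dbar f w = 0
    · have : F w = 0 := by
        ext z
        simp [hFapp, hw]
      rw [this]
      exact zero_mem _
    · have hw0 : w ≠ 0 := by
        have := hfU (tsupport_dbar_subset f (subset_tsupport _ hw))
        exact this.2
      have hwK : w ∉ K := fun h => hw (hK' w h).self_of_nhds
      have hne : ∀ z ∈ K, w - z ≠ 0 := fun z hz h => hwK (sub_eq_zero.mp h ▸ hz)
      have hval : ∀ z, (1 - C w⁻¹ * X : ℂ[X]).eval z = w⁻¹ * (w - z) := fun z => by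
        simp only [eval_sub, eval_one, eval_mul, eval_C, eval_X]
        field_simp
      refine ⟨C (w⁻¹ * dbar f w), 1 - C w⁻¹ * X, by simp, fun z hz => ?_, fun z => ?_⟩
      · rw [hval]
        exact mul_ne_zero (inv_ne_zero hw0) (hne z hz)
      · rw [hval, hFapp, eval_C, mul_div_mul_left _ _ (inv_ne_zero hw0)]
  have hint := integral_mem_of_isClosed _ (Submodule.isClosed_topologicalClosure _)
    F.continuous hFs hFmem
  have hFi : Integrable F := F.continuous.integrable_of_hasCompactSupport hFs
  -- Evaluation at `z` commutes with the integral, and Cauchy–Pompeiu identifies the value.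
  have hval : ∀ z : K, (∫ w, F w) z = -(Real.pi * Q z) := fun z => by
    have h1 := (ContinuousMap.evalCLM ℂ z).integral_comp_comm hFi
    simp only [ContinuousMap.evalCLM_apply] at h1
    rw [← h1]
    simp only [hFapp]
    rw [integral_dbar_div_sub hf hfc, (hfK z z.2).self_of_nhds]
  have hmem := Submodule.smul_mem _ (-(Real.pi : ℂ)⁻¹) hint
  obtain ⟨g, ⟨A, B, hB, hBK, hg⟩, hgd⟩ := Metric.mem_closure_iff.mp hmem ε hε
  refine ⟨A, B, hB, hBK, fun z hz => ?_⟩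
  have h2 := (ContinuousMap.dist_apply_le_dist (f := -(Real.pi : ℂ)⁻¹ • ∫ w, F w) (g := g)
    ⟨z, hz⟩).trans_lt hgd
  rw [ContinuousMap.smul_apply, hval, hg, dist_comm, dist_eq_norm] at h2
  have hpi : (Real.pi : ℂ) ≠ 0 := by exact_mod_cast Real.pi_ne_zero
  simpa [hpi] using h2


/-! ### Padé approximants as solutions of a Hankel system. -/

/-- `B` is a unit among power series, so multiplying by it linearizes the condition without loss. -/
lemma isPadeApproximant_iff {a : ℕ → ℂ} {p q : ℕ} {A B : ℂ[X]} :
    IsPadeApproximant a p q A B ↔ A.natDegree ≤ p ∧ B.natDegree ≤ q ∧ B.coeff 0 = 1 ∧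
      (PowerSeries.X : PowerSeries ℂ) ^ (p + q + 1) ∣ (A : PowerSeries ℂ) - PowerSeries.mk a * B := by
  refine and_congr_right fun _ => and_congr_right fun _ => and_congr_right fun hB => ?_
  have hc : PowerSeries.constantCoeff (B : PowerSeries ℂ) ≠ 0 := by simp [hB]
  have h1 : (B : PowerSeries ℂ)⁻¹ * B = 1 := PowerSeries.inv_mul_cancel _ hc
  have h2 : (∀ v ≤ p + q, PowerSeries.coeff v ((A : PowerSeries ℂ) * (B : PowerSeries ℂ)⁻¹) = a v) ↔
      (PowerSeries.X : PowerSeries ℂ) ^ (p + q + 1) ∣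
        (A : PowerSeries ℂ) * (B : PowerSeries ℂ)⁻¹ - PowerSeries.mk a := by
    simp [PowerSeries.X_pow_dvd_iff, sub_eq_zero]
  rw [h2]
  constructor
  · intro h
    convert h.mul_right (B : PowerSeries ℂ) using 1
    linear_combination (-(A : PowerSeries ℂ)) * h1
  · intro h
    convert h.mul_right (B : PowerSeries ℂ)⁻¹ using 1
    linear_combination (PowerSeries.mk a) * h1

/-- Any two Padé approximants of the same type give the same rational function. -/
lemma IsPadeApproximant.mul_eq_mul {a : ℕ → ℂ} {p q : ℕ} {A B A' B' : ℂ[X]}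
    (h : IsPadeApproximant a p q A B) (h' : IsPadeApproximant a p q A' B') :
    A * B' = A' * B := by
  obtain ⟨hA, hB, -, hd⟩ := isPadeApproximant_iff.mp h
  obtain ⟨hA', hB', -, hd'⟩ := isPadeApproximant_iff.mp h'
  have hdvd : (PowerSeries.X : PowerSeries ℂ) ^ (p + q + 1) ∣
      ((A * B' - A' * B : ℂ[X]) : PowerSeries ℂ) := by
    convert (hd.mul_right (B' : PowerSeries ℂ)).sub (hd'.mul_right (B : PowerSeries ℂ)) using 1
    push_cast
    ring
  rw [PowerSeries.X_pow_dvd_iff] at hdvd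
  ext n
  rw [← sub_eq_zero, ← coeff_sub]
  by_cases hn : n < p + q + 1
  · simpa only [Polynomial.coeff_coe] using hdvd n hn
  · refine coeff_eq_zero_of_natDegree_lt (lt_of_le_of_lt ?_ (not_lt.mp hn))
    exact (natDegree_sub_le _ _).trans (max_le (natDegree_mul_le_of_le hA hB')
      (natDegree_mul_le_of_le hA' hB))

/-- The polynomial `1 + d_{q-1} X + ⋯ + d_0 X^q`. -/
noncomputable def denominator {q : ℕ} (d : Fin q → ℂ) : ℂ[X] :=
  1 + ∑ j, C (d j) * X ^ (q - (j : ℕ))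

lemma coeff_denominator {q : ℕ} (d : Fin q → ℂ) (j : Fin q) :
    (denominator d).coeff (q - j) = d j := by
  have hj := j.2
  have h1 : q - (j : ℕ) ≠ 0 := by omega
  simp only [denominator, coeff_add, coeff_one, h1, if_false, finsetSum_coeff, coeff_C_mul,
    coeff_X_pow, zero_add]
  rw [Finset.sum_eq_single j]
  · simp
  · intro i _ hi
    have : q - (j : ℕ) ≠ q - (i : ℕ) := fun h => hi (Fin.ext (by have := i.2; omega))
    simp [this]
  · simp

lemma coeff_zero_denominator {q : ℕ} (d : Fin q → ℂ) : (denominator d).coeff 0 = 1 := by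
  have h : ∀ j : Fin q, (0 : ℕ) ≠ q - (j : ℕ) := fun j => by have := j.2; omega
  simp [denominator, coeff_X_pow, h]

lemma natDegree_denominator_le {q : ℕ} (d : Fin q → ℂ) : (denominator d).natDegree ≤ q := by
  refine (natDegree_add_le _ _).trans (max_le (by simp) (natDegree_sum_le_of_forall_le _ _ ?_))
  exact fun j _ => (natDegree_C_mul_X_pow_le _ _).trans (Nat.sub_le _ _)

lemma denominator_coeff {q : ℕ} {B : ℂ[X]} (hB : B.natDegree ≤ q) (hB0 : B.coeff 0 = 1) :
    denominator (fun j : Fin q => B.coeff (q - j)) = B := by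
  ext n
  rcases Nat.eq_zero_or_pos n with rfl | hn
  · rw [coeff_zero_denominator, hB0]
  · by_cases hnq : n ≤ q
    · have h := coeff_denominator (fun j : Fin q => B.coeff (q - j)) ⟨q - n, by omega⟩
      simpa [Nat.sub_sub_self hnq] using h
    · rw [coeff_eq_zero_of_natDegree_lt (hB.trans_lt (not_le.mp hnq)),
        coeff_eq_zero_of_natDegree_lt ((natDegree_denominator_le _).trans_lt (not_le.mp hnq))]

lemma coeff_mk_mul_X_pow (a : ℕ → ℂ) (n d : ℕ) :
    PowerSeries.coeff n (PowerSeries.mk a * PowerSeries.X ^ d) =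
      intCoeff a ((n : ℤ) - (d : ℤ)) := by
  rw [PowerSeries.coeff_mul_X_pow', intCoeff]
  by_cases h : d ≤ n
  · have h1 : ¬ ((n : ℤ) - d < 0) := by omega
    have h2 : ((n : ℤ) - d).toNat = n - d := by omega
    simp [h, h1, h2]
  · have h1 : (n : ℤ) - d < 0 := by omega
    simp [h, h1]

/-- Attaching `d j` to `X ^ (q - j)` makes the index `p + 1 + i - (q - j)` a function of `i + j`, so
the matrix is Hankel rather than Toeplitz. -/
lemma coeff_mk_mul_denominator (a : ℕ → ℂ) (p : ℕ) {q : ℕ} (d : Fin q → ℂ) (i : Fin q) :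
    PowerSeries.coeff (p + 1 + i) (PowerSeries.mk a * (denominator d : PowerSeries ℂ)) =
      a (p + 1 + i) + (hankel a p q).mulVec d i := by
  have h : (denominator d : PowerSeries ℂ) =
      1 + ∑ j, PowerSeries.C (d j) * PowerSeries.X ^ (q - (j : ℕ)) := by
    rw [denominator, Polynomial.coe_add, Polynomial.coe_one]
    congr 1
    rw [← Polynomial.coeToPowerSeries.ringHom_apply, map_sum]
    simp
  rw [h, mul_add, mul_one, map_add, PowerSeries.coeff_mk, Finset.mul_sum, map_sum]
  congr 1
  refine Finset.sum_congr rfl fun j _ => ?_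
  rw [mul_left_comm, PowerSeries.coeff_C_mul, coeff_mk_mul_X_pow, mul_comm]
  congr 2
  have := j.2
  push_cast [Nat.cast_sub this.le]
  ring

/-- The polynomial of degree at most `p` whose quotient by `B` agrees with the power series with
coefficients `a` in the terms of index `0, …, p`. -/
noncomputable def numerator (a : ℕ → ℂ) (p : ℕ) (B : ℂ[X]) : ℂ[X] :=
  PowerSeries.trunc (p + 1) (PowerSeries.mk a * B)

lemma natDegree_numerator_le (a : ℕ → ℂ) (p : ℕ) (B : ℂ[X]) : (numerator a p B).natDegree ≤ p :=
  Nat.lt_succ_iff.mp (PowerSeries.natDegree_trunc_lt _ _)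

/-- Orders `0, …, p` determine the numerator as a truncation; orders `p + 1, …, p + q` are a linear
system for `d`. -/
lemma isPadeApproximant_denominator_iff {a : ℕ → ℂ} {p q : ℕ} {A : ℂ[X]} {d : Fin q → ℂ} :
    IsPadeApproximant a p q A (denominator d) ↔ A = numerator a p (denominator d) ∧
      (hankel a p q).mulVec d = fun i : Fin q => - a (p + 1 + i) := by
  rw [isPadeApproximant_iff]
  simp only [natDegree_denominator_le, coeff_zero_denominator, true_and,
    PowerSeries.X_pow_dvd_iff, map_sub, Polynomial.coeff_coe, sub_eq_zero]
  constructor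
  · rintro ⟨hA, h⟩
    refine ⟨?_, funext fun i => ?_⟩
    · ext n
      rw [numerator, PowerSeries.coeff_trunc]
      split_ifs with hn
      · exact h n (by omega)
      · exact coeff_eq_zero_of_natDegree_lt (by omega)
    · have h1 := h (p + 1 + i) (by have := i.2; omega)
      rw [coeff_mk_mul_denominator, coeff_eq_zero_of_natDegree_lt (by omega)] at h1
      linear_combination -h1
  · rintro ⟨rfl, h⟩
    refine ⟨natDegree_numerator_le _ _ _, fun n hn => ?_⟩
    rw [numerator, PowerSeries.coeff_trunc]
    split_ifs with hnp
    · rfl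
    · obtain ⟨i, rfl⟩ := Nat.exists_eq_add_of_le (not_lt.mp hnp)
      have h1 := coeff_mk_mul_denominator a p d ⟨i, by omega⟩
      rw [h] at h1
      rw [h1]
      ring

/-- A power series with a Padé approximant in lowest terms whose denominator has full degree is
regular. -/
lemma mem_padeRegular_of_isCoprime {a : ℕ → ℂ} {p q : ℕ} {A B : ℂ[X]}
    (h : IsPadeApproximant a p q A B) (hAB : IsCoprime A B) (hq : B.natDegree = q) :
    a ∈ padeRegular p q := by
  intro hdet
  obtain ⟨c, hc, hHc⟩ := Matrix.exists_mulVec_eq_zero_iff.mpr hdet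
  set d : Fin q → ℂ := fun j => B.coeff (q - j) with hd
  have hdB : denominator d = B := denominator_coeff h.2.1 h.2.2.1
  have h1 := h
  rw [← hdB, isPadeApproximant_denominator_iff] at h1
  -- A kernel vector `c` yields a second approximant. Coprimality makes `B` divide its denominator,
  -- and the full degree and constant term `1` force equality, so `c = 0`.
  have h2 : IsPadeApproximant a p q (numerator a p (denominator (d + c))) (denominator (d + c)) :=
    isPadeApproximant_denominator_iff.mpr ⟨rfl, by rw [Matrix.mulVec_add, hHc, add_zero, h1.2]⟩
  have h3 : B ∣ denominator (d + c) :=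
    hAB.symm.dvd_of_dvd_mul_left (Dvd.intro_left _ (h.mul_eq_mul h2).symm)
  obtain ⟨E, hE⟩ := h3
  have hB0 : B ≠ 0 := by
    rintro rfl
    simpa using h.2.2.1
  have hE0 : E.coeff 0 = 1 := by
    have := congrArg (fun P : ℂ[X] => P.coeff 0) hE
    simpa [coeff_zero_denominator, mul_coeff_zero, h.2.2.1] using this.symm
  have hEne : E ≠ 0 := by
    rintro rfl
    simp at hE0
  have hEd : E.natDegree = 0 := by
    have := natDegree_denominator_le (d + c)
    rw [hE, natDegree_mul hB0 hEne] at this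
    omega
  have hE1 : E = 1 := by rw [eq_C_of_natDegree_eq_zero hEd, hE0, C_1]
  rw [hE1, mul_one, ← hdB] at hE
  refine hc (funext fun j => ?_)
  have := coeff_denominator (d + c) j
  rw [hE, coeff_denominator] at this
  simpa using this


/-! ### Constructing series with good exact approximants. -/

/-- Approximation on a compact set that does not contain `0`, by a rational function with prescribed
Taylor coefficients of index at most `N` at `0`. -/
lemma exists_rational_approx_interpolating {K : Set ℂ} (hK : IsCompact K) (hK0 : (0 : ℂ) ∉ K)
    {Q : ℂ → ℂ} (hQ : HolomorphicNear Q K) {ε : ℝ} (hε : 0 < ε) (P : ℂ[X]) (N : ℕ) :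
    ∃ S B : ℂ[X], B.coeff 0 = 1 ∧ (∀ z ∈ K, B.eval z ≠ 0) ∧
      ∀ z ∈ K, ‖(P * B + X ^ N * S).eval z / B.eval z - Q z‖ < ε := by
  obtain ⟨U, hU, hKU, hQU⟩ := hQ
  obtain ⟨M, hM⟩ := hK.exists_bound_of_continuousOn (f := fun z : ℂ => z ^ N) (by fun_prop)
  have hM' : 0 < |M| + 1 := by positivity
  have hol : HolomorphicNear (fun z => (Q z - P.eval z) / z ^ N) K := by
    refine ⟨U ∩ {0}ᶜ, hU.inter isOpen_compl_singleton,
      fun z hz => ⟨hKU hz, fun h => hK0 ((show z = 0 from h) ▸ hz)⟩, ?_⟩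
    refine DifferentiableOn.div ((hQU.mono inter_subset_left).sub P.differentiable.differentiableOn)
      (by fun_prop) fun z hz => pow_ne_zero _ hz.2
  obtain ⟨S, B, hB, hBK, h⟩ := exists_rational_approx hK hK0 hol (div_pos hε hM')
  refine ⟨S, B, hB, hBK, fun z hz => ?_⟩
  have hz0 : z ≠ 0 := fun h => hK0 (h ▸ hz)
  have hBz := hBK z hz
  have e : (P * B + X ^ N * S).eval z / B.eval z - Q z =
      z ^ N * (S.eval z / B.eval z - (Q z - P.eval z) / z ^ N) := by
    simp only [eval_add, eval_mul, eval_pow, eval_X]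
    field_simp
    ring
  rw [e, norm_mul]
  calc ‖z ^ N‖ * ‖S.eval z / B.eval z - (Q z - P.eval z) / z ^ N‖
      ≤ (|M| + 1) * ‖S.eval z / B.eval z - (Q z - P.eval z) / z ^ N‖ := by
        gcongr
        linarith [hM z hz, le_abs_self M]
    _ < (|M| + 1) * (ε / (|M| + 1)) := by
        gcongr
        exact h z hz
    _ = ε := by field_simp

/-- A rational function without poles on a compact set can be approximated there by one in lowest
terms with prescribed large degrees `p` and `q`. -/
lemma exists_isCoprime_approx {K : Set ℂ} (hK : IsCompact K) {A₀ B₀ : ℂ[X]}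
    (hB₀ : B₀.coeff 0 = 1) (hBK : ∀ z ∈ K, B₀.eval z ≠ 0) {p q : ℕ} (hq : B₀.natDegree < q)
    (hp : A₀.natDegree + q < p) {ε : ℝ} (hε : 0 < ε) :
    ∃ (D : ℂ[X]) (δ : ℂ), D.coeff 0 = 1 ∧ (B₀ * D).natDegree = q ∧
      (A₀ * D + C δ * X ^ p).natDegree = p ∧ IsCoprime (A₀ * D + C δ * X ^ p) (B₀ * D) ∧
      (∀ z ∈ K, (B₀ * D).eval z ≠ 0) ∧
      ∀ z ∈ K, ‖(A₀ * D + C δ * X ^ p).eval z / (B₀ * D).eval z - A₀.eval z / B₀.eval z‖ < ε := by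
  obtain ⟨k, hk, rfl⟩ : ∃ k, 0 < k ∧ q = B₀.natDegree + k :=
    ⟨q - B₀.natDegree, by omega, by omega⟩
  obtain ⟨M, hM⟩ := hK.exists_bound_of_continuousOn (f := fun z : ℂ => z ^ k) (by fun_prop)
  have hM' : 0 < |M| + 1 := by positivity
  -- With this `η`, `|η z ^ k| < 1` on `K`, so `D = 1 + η X ^ k` has no zeros there.
  set η : ℂ := (((|M| + 1)⁻¹ : ℝ) : ℂ) with hη
  have hη0 : η ≠ 0 := by
    rw [hη]
    exact_mod_cast (inv_pos.mpr hM').ne'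
  set D : ℂ[X] := 1 + C η * X ^ k with hD
  have hD0 : D.coeff 0 = 1 := by simp [hD, hk.ne]
  have hDk : D.natDegree = k := by
    rw [hD, natDegree_add_eq_right_of_natDegree_lt, natDegree_C_mul_X_pow _ _ hη0]
    rw [natDegree_C_mul_X_pow _ _ hη0]
    simpa using hk
  have hDK : ∀ z ∈ K, D.eval z ≠ 0 := fun z hz h => by
    have h1 : η * z ^ k = -1 := by
      simp only [hD, eval_add, eval_one, eval_mul, eval_C, eval_pow, eval_X] at h
      linear_combination h
    have h2 : ‖η * z ^ k‖ < 1 := by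
      rw [norm_mul, hη, Complex.norm_real, Real.norm_of_nonneg (inv_pos.mpr hM').le,
        inv_mul_lt_iff₀ hM', mul_one]
      linarith [hM z hz, le_abs_self M]
    rw [h1] at h2
    simp at h2
  have hB₀' : B₀ ≠ 0 := by
    rintro rfl
    simp at hB₀
  have hD' : D ≠ 0 := by
    intro h
    simp [h] at hD0
  set B := B₀ * D with hB
  have hB0 : B ≠ 0 := mul_ne_zero hB₀' hD'
  have hBK' : ∀ z ∈ K, B.eval z ≠ 0 := fun z hz => by
    rw [hB, eval_mul]
    exact mul_ne_zero (hBK z hz) (hDK z hz)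
  have hBd : B.natDegree = B₀.natDegree + k := by rw [hB, natDegree_mul hB₀' hD', hDk]
  obtain ⟨M', hM''⟩ := hK.exists_bound_of_continuousOn (f := fun z : ℂ => z ^ p / B.eval z)
    (ContinuousOn.div (by fun_prop) B.continuous.continuousOn hBK')
  have hM''' : 0 < |M'| + 1 := by positivity
  -- The excluded values are `0`, which would lose the degree `p`, and the finitely many `δ` for
  -- which the numerator vanishes at a zero of `B`.
  obtain ⟨δ, hδ, hδB⟩ := (infinite_of_mem_nhds (0 : ℂ)
    (Metric.ball_mem_nhds 0 (div_pos hε hM'''))).exists_notMem_finset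
    (insert 0 (B.roots.toFinset.image fun w => -(A₀ * D).eval w / w ^ p))
  simp only [Finset.mem_insert, Finset.mem_image, Multiset.mem_toFinset, not_or, not_exists,
    not_and] at hδB
  obtain ⟨hδ0, hδB⟩ := hδB
  refine ⟨D, δ, hD0, hBd, ?_, ?_, hBK', fun z hz => ?_⟩
  · rw [natDegree_add_eq_right_of_natDegree_lt, natDegree_C_mul_X_pow _ _ hδ0]
    rw [natDegree_C_mul_X_pow _ _ hδ0]
    refine natDegree_mul_le.trans_lt ?_
    omega
  · rw [isCoprime_iff_aeval_ne_zero_of_isAlgClosed ℂ ℂ]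
    intro w
    by_contra! h
    simp only [coe_aeval_eq_eval] at h
    have hw0 : w ≠ 0 := by
      rintro rfl
      have := h.2
      rw [← coeff_zero_eq_eval_zero, mul_coeff_zero, hB₀, hD0] at this
      simp at this
    refine hδB w ((mem_roots hB0).mpr h.2) ?_
    have h1 := h.1
    rw [eval_add, eval_mul (p := C δ), eval_C, eval_pow, eval_X] at h1
    rw [div_eq_iff (pow_ne_zero _ hw0)]
    linear_combination -h1
  · have hBz := hBK z hz
    have hDz := hDK z hz
    have e : (A₀ * D + C δ * X ^ p).eval z / B.eval z - A₀.eval z / B₀.eval z =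
        δ * (z ^ p / B.eval z) := by
      rw [hB]
      simp only [eval_add, eval_mul, eval_pow, eval_X, eval_C]
      field_simp
      ring
    rw [e, norm_mul]
    rw [mem_ball_zero_iff, lt_div_iff₀ hM'''] at hδ
    refine lt_of_le_of_lt ?_ hδ
    gcongr
    linarith [hM'' z hz, le_abs_self M']

lemma ConditionH.exists_large {J : Set (ℕ × ℕ)} (hJ : ConditionH J) (M N : ℕ) :
    ∃ p q, (p, q) ∈ J ∧ M < q ∧ N + q < p := by
  obtain ⟨p, q, hpq, hq, hd⟩ := hJ
  obtain ⟨n, h1, h2⟩ := ((hq.eventually_gt_atTop M).and (hd.eventually_gt_atTop (N : ℤ))).exists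
  exact ⟨p n, q n, hpq n, h1, by omega⟩

/-- There are power series with prescribed coefficients of index at most `N` that have an exact Padé
approximant close to a given function on `K`. -/
lemma exists_exact_approximant {J : Set (ℕ × ℕ)} (hJ : ConditionH J) {K : Set ℂ} (hK : IsCompact K)
    (hK0 : (0 : ℂ) ∉ K) {Q : ℂ → ℂ} (hQ : HolomorphicNear Q K) {ε : ℝ} (hε : 0 < ε)
    (a₀ : ℕ → ℂ) (N : ℕ) :
    ∃ (a : ℕ → ℂ) (p q : ℕ) (A B : ℂ[X]), (∀ v < N, a v = a₀ v) ∧ (p, q) ∈ J ∧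
      a ∈ padeRegular p q ∧ IsExactPadeApproximant a p q A B ∧ (∀ z ∈ K, B.eval z ≠ 0) ∧
      ∀ z ∈ K, ‖A.eval z / B.eval z - Q z‖ < ε := by
  set P := PowerSeries.trunc N (PowerSeries.mk a₀) with hP
  obtain ⟨S, B₀, hB₀, hBK, happ⟩ :=
    exists_rational_approx_interpolating hK hK0 hQ (half_pos hε) P N
  set A₀ := P * B₀ + X ^ N * S with hA₀
  -- The extra `N` gives `p ≥ N`, so that adding `δ X ^ p` leaves the coefficients below `N`
  -- unchanged.
  obtain ⟨p, q, hpq, hq, hp⟩ := hJ.exists_large B₀.natDegree (A₀.natDegree + N)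
  obtain ⟨D, δ, hD, hBd, hAd, hcop, hBK', happ'⟩ :=
    exists_isCoprime_approx hK hB₀ hBK hq (p := p) (A₀ := A₀) (by omega) (half_pos hε)
  set B := B₀ * D with hB
  set A := A₀ * D + C δ * X ^ p with hA
  have hB1 : B.coeff 0 = 1 := by rw [hB, mul_coeff_zero, hB₀, hD, mul_one]
  clear_value A B
  let a : ℕ → ℂ := fun v => PowerSeries.coeff v ((A : PowerSeries ℂ) * (B : PowerSeries ℂ)⁻¹)
  have hpade : IsPadeApproximant a p q A B := ⟨hAd.le, hBd.le, hB1, fun _ _ => rfl⟩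
  have hlead : ∀ {F : ℂ[X]} {n : ℕ}, 0 < n → F.natDegree = n → F.coeff n ≠ 0 := by
    rintro F n hn rfl h
    rw [coeff_natDegree, leadingCoeff_eq_zero] at h
    simp [h] at hn
  refine ⟨a, p, q, A, B, fun v hv => ?_, hpq, mem_padeRegular_of_isCoprime hpade hcop hBd,
    ⟨hpade, mul_ne_zero (hlead (by omega) hAd) (hlead (by omega) hBd)⟩, hBK', fun z hz => ?_⟩
  · have hBinv : (B : PowerSeries ℂ) * (B : PowerSeries ℂ)⁻¹ = 1 :=
      PowerSeries.mul_inv_cancel _ (by simp [hB1])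
    have hAB : A = P * B + X ^ N * (S * D + C δ * X ^ (p - N)) := by
      have : (X : ℂ[X]) ^ p = X ^ N * X ^ (p - N) := by
        rw [← pow_add]
        congr 1
        omega
      rw [hA, hB, hA₀, this]
      ring
    generalize S * D + C δ * X ^ (p - N) = E at hAB
    have hs : (A : PowerSeries ℂ) * (B : PowerSeries ℂ)⁻¹ = (P : PowerSeries ℂ) +
        PowerSeries.X ^ N * ((E : PowerSeries ℂ) * (B : PowerSeries ℂ)⁻¹) := by
      have h := congrArg (fun F : ℂ[X] => (F : PowerSeries ℂ)) hAB
      simp only [Polynomial.coe_add, Polynomial.coe_mul, Polynomial.coe_pow, Polynomial.coe_X] at h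
      linear_combination (B : PowerSeries ℂ)⁻¹ * h + (P : PowerSeries ℂ) * hBinv
    have hdvd := PowerSeries.X_pow_dvd_iff.mp (Dvd.intro _ rfl :
      (PowerSeries.X : PowerSeries ℂ) ^ N ∣ PowerSeries.X ^ N *
        ((E : PowerSeries ℂ) * (B : PowerSeries ℂ)⁻¹)) v hv
    simp only [a, hs, map_add, hdvd, add_zero, Polynomial.coeff_coe, hP, PowerSeries.coeff_trunc,
      if_pos hv, PowerSeries.coeff_mk]
  · calc ‖A.eval z / B.eval z - Q z‖ ≤ ‖A.eval z / B.eval z - A₀.eval z / B₀.eval z‖ +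
          ‖A₀.eval z / B₀.eval z - Q z‖ := norm_sub_le_norm_sub_add_norm_sub _ _ _
      _ < ε / 2 + ε / 2 := add_lt_add (happ' z hz) (happ z hz)
      _ = ε := add_halves ε


/-! ### Continuous dependence of the approximant on the series. -/

/-- The denominator of the Padé approximant of type `(p, q)`, given by Cramer's rule. -/
noncomputable def padeDenominator (a : ℕ → ℂ) (p q : ℕ) : ℂ[X] :=
  denominator ((hankel a p q)⁻¹.mulVec fun i : Fin q => -a (p + 1 + i))

/-- The numerator of the Padé approximant of type `(p, q)`. -/
noncomputable def padeNumerator (a : ℕ → ℂ) (p q : ℕ) : ℂ[X] :=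
  numerator a p (padeDenominator a p q)

lemma isPadeApproximant_iff_of_mem {a : ℕ → ℂ} {p q : ℕ} (ha : a ∈ padeRegular p q) {A B : ℂ[X]} :
    IsPadeApproximant a p q A B ↔ A = padeNumerator a p q ∧ B = padeDenominator a p q := by
  have hu : IsUnit (hankel a p q).det := isUnit_iff_ne_zero.mpr ha
  constructor
  · intro h
    have hB := denominator_coeff h.2.1 h.2.2.1
    rw [← hB, isPadeApproximant_denominator_iff] at h
    have : B = padeDenominator a p q := by
      rw [padeDenominator, ← h.2, Matrix.mulVec_mulVec, Matrix.nonsing_inv_mul _ hu,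
        Matrix.one_mulVec, hB]
    refine ⟨?_, this⟩
    rw [h.1, hB, padeNumerator, this]
  · rintro ⟨rfl, rfl⟩
    refine isPadeApproximant_denominator_iff.mpr ⟨rfl, ?_⟩
    rw [Matrix.mulVec_mulVec, Matrix.mul_nonsing_inv _ hu, Matrix.one_mulVec]

lemma continuous_intCoeff (k : ℤ) : Continuous fun a : ℕ → ℂ => intCoeff a k := by
  unfold intCoeff
  split_ifs <;> fun_prop

lemma continuous_hankel (p q : ℕ) : Continuous fun a : ℕ → ℂ => hankel a p q :=
  continuous_matrix fun _ _ => continuous_intCoeff _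

lemma isOpen_padeRegular (p q : ℕ) : IsOpen (padeRegular p q) :=
  isOpen_ne_fun (continuous_hankel p q).matrix_det continuous_const

lemma continuousAt_coeff_padeDenominator {a : ℕ → ℂ} {p q : ℕ} (ha : a ∈ padeRegular p q) (k : ℕ) :
    ContinuousAt (fun a => (padeDenominator a p q).coeff k) a := by
  have hinv : ∀ i j, ContinuousAt (fun a : ℕ → ℂ => (hankel a p q)⁻¹ i j) a := fun i j => by
    simp only [Matrix.inv_def, Ring.inverse_eq_inv', Matrix.smul_apply, smul_eq_mul]
    exact ((continuous_hankel p q).matrix_det.continuousAt.inv₀ ha).mul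
      ((continuous_hankel p q).matrix_adjugate.matrix_elem i j).continuousAt
  have hd : ∀ j, ContinuousAt (fun a : ℕ → ℂ =>
      (hankel a p q)⁻¹.mulVec (fun i : Fin q => -a (p + 1 + i)) j) a := fun j => by
    simp only [Matrix.mulVec, dotProduct]
    exact tendsto_finsetSum _ fun i _ => (hinv j i).mul (continuous_apply _).neg.continuousAt
  simp only [padeDenominator, denominator, coeff_add, finsetSum_coeff, coeff_C_mul]
  exact continuousAt_const.add (tendsto_finsetSum _ fun j _ => (hd j).mul continuousAt_const)

lemma continuousAt_coeff_padeNumerator {a : ℕ → ℂ} {p q : ℕ} (ha : a ∈ padeRegular p q) (k : ℕ) :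
    ContinuousAt (fun a => (padeNumerator a p q).coeff k) a := by
  simp only [padeNumerator, numerator, PowerSeries.coeff_trunc]
  split_ifs
  · simp only [PowerSeries.coeff_mul, PowerSeries.coeff_mk, Polynomial.coeff_coe]
    refine tendsto_finsetSum _ fun i _ => ?_
    exact ((continuous_apply i.1).continuousAt).mul (continuousAt_coeff_padeDenominator ha i.2)
  · exact continuousAt_const

/-- The uniform degree bound turns evaluation into a sum of fixed length, giving joint continuity in
the parameter and the point. -/
lemma continuousAt_eval {X : Type*} [TopologicalSpace X] {P : X → ℂ[X]} {n : ℕ} {x : X}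
    (hn : ∀ x, (P x).natDegree ≤ n) (hP : ∀ k, ContinuousAt (fun x => (P x).coeff k) x) (z : ℂ) :
    ContinuousAt (fun y : X × ℂ => (P y.1).eval y.2) (x, z) := by
  have : (fun y : X × ℂ => (P y.1).eval y.2) =
      fun y => ∑ k ∈ Finset.range (n + 1), (P y.1).coeff k * y.2 ^ k :=
    funext fun y => eval_eq_sum_range' (Nat.lt_succ_of_le (hn _)) _
  rw [this]
  refine tendsto_finsetSum _ fun k _ => ContinuousAt.mul ?_ (by fun_prop)
  exact ContinuousAt.comp (f := Prod.fst) (x := (x, z)) (hP k) continuousAt_fst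

/-! ### The Baire category argument. -/

/-- The power series that have, for some index in `J`, a Padé approximant without poles on `K` whose
distance to `g` on `K` is less than `ε`. -/
def approximable (IsApprox : (ℕ → ℂ) → ℕ → ℕ → Polynomial ℂ → Polynomial ℂ → Prop)
    (J : Set (ℕ × ℕ)) (K : Set ℂ) (g : K → ℂ) (ε : ℝ) : Set (ℕ → ℂ) :=
  {a | ∃ (p q : ℕ) (A B : ℂ[X]), (p, q) ∈ J ∧ a ∈ padeRegular p q ∧ IsApprox a p q A B ∧
    (∀ z : K, B.eval (z : ℂ) ≠ 0) ∧ ∀ z : K, ‖A.eval (z : ℂ) / B.eval (z : ℂ) - g z‖ < ε}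

variable {IsApprox : (ℕ → ℂ) → ℕ → ℕ → Polynomial ℂ → Polynomial ℂ → Prop}

/-- The open set `V` treats both classes at once: `univ` for all approximants, `{0}ᶜ` for exact
ones. Pointwise open conditions hold uniformly over `K` by compactness (tube lemma). -/
lemma isOpen_approximable {V : Set ℂ} (hV : IsOpen V)
    (hIs : ∀ a p q A B, IsApprox a p q A B ↔
      IsPadeApproximant a p q A B ∧ A.coeff p * B.coeff q ∈ V)
    (J : Set (ℕ × ℕ)) {K : Set ℂ} (hK : IsCompact K) (g : C(K, ℂ)) (ε : ℝ) :
    IsOpen (approximable IsApprox J K g ε) := by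
  rw [isOpen_iff_mem_nhds]
  rintro a ⟨p, q, A, B, hpq, ha, hAB, hBK, hg⟩
  rw [hIs, isPadeApproximant_iff_of_mem ha] at hAB
  obtain ⟨⟨rfl, rfl⟩, hlead⟩ := hAB
  have : CompactSpace K := isCompact_iff_compactSpace.mp hK
  have hincl : ∀ z : K, ContinuousAt (fun y : (ℕ → ℂ) × K => (y.1, (y.2 : ℂ))) (a, z) :=
    fun z => by fun_prop
  have hden : ∀ z : K, ContinuousAt
      (fun y : (ℕ → ℂ) × K => (padeDenominator y.1 p q).eval (y.2 : ℂ)) (a, z) := fun z =>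
    ContinuousAt.comp (f := fun y : (ℕ → ℂ) × K => (y.1, (y.2 : ℂ))) (x := (a, z))
      (continuousAt_eval (P := fun a => padeDenominator a p q) (n := q)
        (fun _ => natDegree_denominator_le _)
        (continuousAt_coeff_padeDenominator ha) z) (hincl z)
  have hnum : ∀ z : K, ContinuousAt
      (fun y : (ℕ → ℂ) × K => (padeNumerator y.1 p q).eval (y.2 : ℂ)) (a, z) := fun z =>
    ContinuousAt.comp (f := fun y : (ℕ → ℂ) × K => (y.1, (y.2 : ℂ))) (x := (a, z))
      (continuousAt_eval (P := fun a => padeNumerator a p q) (n := p)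
        (fun _ => natDegree_numerator_le _ _ _)
        (continuousAt_coeff_padeNumerator ha) z) (hincl z)
  have h1 : ∀ᶠ b in 𝓝 a, ∀ z ∈ (univ : Set K), (padeDenominator b p q).eval (z : ℂ) ≠ 0 :=
    isCompact_univ.eventually_forall_of_forall_eventually fun z _ =>
      (hden z).eventually_ne (hBK z)
  have h2 : ∀ᶠ b in 𝓝 a, ∀ z ∈ (univ : Set K),
      ‖(padeNumerator b p q).eval (z : ℂ) / (padeDenominator b p q).eval (z : ℂ) - g z‖ < ε :=
    isCompact_univ.eventually_forall_of_forall_eventually fun z _ => by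
      have hc := (((hnum z).div (hden z) (hBK z)).sub
        (g.continuous.comp continuous_snd).continuousAt).norm
      exact hc.eventually_lt_const (hg z)
  have h3 : ∀ᶠ b in 𝓝 a, (padeNumerator b p q).coeff p * (padeDenominator b p q).coeff q ∈ V :=
    ((continuousAt_coeff_padeNumerator ha p).mul
      (continuousAt_coeff_padeDenominator ha q)).eventually_mem (hV.mem_nhds hlead)
  filter_upwards [h1, h2, h3, (isOpen_padeRegular p q).mem_nhds ha] with b hb1 hb2 hb3 hb
  exact ⟨p, q, _, _, hpq, hb,
    (hIs _ _ _ _ _).mpr ⟨(isPadeApproximant_iff_of_mem hb).mpr ⟨rfl, rfl⟩, hb3⟩,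
    fun z => hb1 z trivial, fun z => hb2 z trivial⟩

lemma dense_approximable
    (hIs : ∀ a p q A B, IsExactPadeApproximant a p q A B → IsApprox a p q A B)
    {J : Set (ℕ × ℕ)} (hJ : ConditionH J) {K : Set ℂ} (hK : IsCompact K) (hK0 : (0 : ℂ) ∉ K)
    {Q : ℂ → ℂ} (hQ : HolomorphicNear Q K) {ε : ℝ} (hε : 0 < ε) :
    Dense (approximable IsApprox J K (fun z => Q z) ε) := by
  intro a₀
  rw [mem_closure_iff_nhds]
  intro W hW
  rw [nhds_pi, Filter.mem_pi] at hW
  obtain ⟨I, hI, t, ht, hW⟩ := hW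
  obtain ⟨N, hN⟩ := hI.bddAbove
  obtain ⟨a, p, q, A, B, hv, hpq, ha, hAB, hBK, hz⟩ :=
    exists_exact_approximant hJ hK hK0 hQ hε a₀ (N + 1)
  refine ⟨a, hW fun v hvI => ?_, p, q, A, B, hpq, ha, hIs _ _ _ _ _ hAB, fun z => hBK z z.2,
    fun z => hz z z.2⟩
  rw [hv v (Nat.lt_succ_of_le (hN hvI))]
  exact mem_of_mem_nhds (ht v)

/-- The indices need not be distinct or tend to infinity, so one approximant for each tolerance
`1/(n+1)` suffices. -/
lemma isUniformPadeLimit_iff {J : Set (ℕ × ℕ)} {K : Set ℂ} {a : ℕ → ℂ} {Q : ℂ → ℂ} :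
    IsUniformPadeLimit IsApprox J K a Q ↔
      ∀ ε > 0, a ∈ approximable IsApprox J K (fun z => Q z) ε := by
  constructor
  · rintro ⟨p, q, A, B, hJ, ha, hAB, hBK, hlim⟩ ε hε
    obtain ⟨n, hn⟩ := (Metric.tendstoUniformlyOn_iff.mp hlim ε hε).exists
    refine ⟨p n, q n, A n, B n, hJ n, ha n, hAB n, fun z => hBK n z z.2, fun z => ?_⟩
    rw [← dist_eq_norm, dist_comm]
    exact hn z z.2
  · intro h
    choose p q A B hJ ha hAB hBK hlim using fun n : ℕ => h (1 / ((n : ℝ) + 1)) (by positivity)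
    refine ⟨p, q, A, B, hJ, ha, hAB, fun n z hz => hBK n ⟨z, hz⟩, ?_⟩
    rw [Metric.tendstoUniformlyOn_iff]
    intro ε hε
    filter_upwards [tendsto_one_div_add_atTop_nhds_zero_nat.eventually_lt_const hε] with n hn z hz
    rw [dist_comm, dist_eq_norm]
    exact (hlim n ⟨z, hz⟩).trans hn

lemma approximable_of_dist_lt {J : Set (ℕ × ℕ)} {K : Set ℂ} {a : ℕ → ℂ} {g h : K → ℂ} {ε η : ℝ}
    (hgh : ∀ z, ‖g z - h z‖ < η) (ha : a ∈ approximable IsApprox J K g ε) :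
    a ∈ approximable IsApprox J K h (ε + η) := by
  obtain ⟨p, q, A, B, hJ, hr, hAB, hBK, hlim⟩ := ha
  exact ⟨p, q, A, B, hJ, hr, hAB, hBK, fun z =>
    (norm_sub_le_norm_sub_add_norm_sub _ (g z) _).trans_lt (add_lt_add (hlim z) (hgh z))⟩

/-- The restrictions to `K` of the functions holomorphic near `K`. -/
def holomorphicRestrictions (K : Set ℂ) : Set C(K, ℂ) :=
  {g | ∃ Q, HolomorphicNear Q K ∧ ∀ z : K, g z = Q z}

lemma HolomorphicNear.exists_mem_restrictions {Q : ℂ → ℂ} {K : Set ℂ} (hQ : HolomorphicNear Q K) :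
    ∃ g ∈ holomorphicRestrictions K, ∀ z : K, g z = Q z := by
  obtain ⟨U, hU, hKU, hQU⟩ := id hQ
  exact ⟨⟨fun z => Q z, continuousOn_iff_continuous_domRestrict.mp (hQU.continuousOn.mono hKU)⟩,
    ⟨Q, hQ, fun _ => rfl⟩, fun _ => rfl⟩

/-- Countably many functions holomorphic near `K` suffice to test uniform approximation on `K`. -/
lemma exists_seq_dense_holomorphic {K : Set ℂ} (hK : IsCompact K) :
    ∃ G : ℕ → C(K, ℂ), (∀ n, G n ∈ holomorphicRestrictions K) ∧
      ∀ Q, HolomorphicNear Q K → ∀ ε > 0, ∃ n, ∀ z : K, ‖G n z - Q z‖ < ε := by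
  have : CompactSpace K := isCompact_iff_compactSpace.mp hK
  have : Nonempty (holomorphicRestrictions K) :=
    ⟨0, 0, ⟨univ, isOpen_univ, subset_univ _, differentiableOn_const 0⟩, fun _ => rfl⟩
  refine ⟨fun n => TopologicalSpace.denseSeq (holomorphicRestrictions K) n,
    fun n => Subtype.mem _, fun Q hQ ε hε => ?_⟩
  obtain ⟨g, hg, hgQ⟩ := hQ.exists_mem_restrictions
  obtain ⟨n, hn⟩ := (TopologicalSpace.denseRange_denseSeq (holomorphicRestrictions K)).exists_dist_lt
    ⟨g, hg⟩ hε
  refine ⟨n, fun z => ?_⟩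
  rw [← hgQ, ← dist_eq_norm, dist_comm]
  exact (ContinuousMap.dist_apply_le_dist z).trans_lt hn

theorem dense_and_isGδ_universalClass {V : Set ℂ} (hV : IsOpen V) (hV0 : {0}ᶜ ⊆ V)
    (hIs : ∀ a p q A B, IsApprox a p q A B ↔
      IsPadeApproximant a p q A B ∧ A.coeff p * B.coeff q ∈ V)
    {J : Set (ℕ × ℕ)} (hJ : ConditionH J) {K : ℕ → Set ℂ} (hK : ∀ m, IsCompact (K m))
    (hK0 : ∀ m, (0 : ℂ) ∉ K m) :
    Dense (universalClass IsApprox J K) ∧ IsGδ (universalClass IsApprox J K) := by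
  choose G hG hGd using fun m => exists_seq_dense_holomorphic (hK m)
  have heq : universalClass IsApprox J K = ⋂ i : ℕ × ℕ × ℕ,
      approximable IsApprox J (K i.1) (G i.1 i.2.1) (1 / ((i.2.2 : ℝ) + 1)) := by
    ext a
    simp only [universalClass, isUniformPadeLimit_iff, mem_ofPred_eq, mem_iInter, Prod.forall]
    constructor
    · intro h m n l
      obtain ⟨Q, hQ, hGQ⟩ := hG m n
      rw [show ⇑(G m n) = fun z : K m => Q z from funext hGQ]
      exact h m Q hQ _ (by positivity)
    · intro h m Q hQ ε hε
      obtain ⟨l, hl⟩ := exists_nat_one_div_lt hε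
      -- The tolerance is what remains of `ε` after the approximation error `1/(l+1)`.
      obtain ⟨n, hn⟩ := hGd m Q hQ (ε - 1 / ((l : ℝ) + 1)) (sub_pos.mpr hl)
      simpa using approximable_of_dist_lt hn (h m n l)
  have hopen : ∀ i : ℕ × ℕ × ℕ, IsOpen
      (approximable IsApprox J (K i.1) (G i.1 i.2.1) (1 / ((i.2.2 : ℝ) + 1))) :=
    fun i => isOpen_approximable hV hIs J (hK _) _ _
  rw [heq]
  refine ⟨dense_iInter_of_isOpen hopen fun i => ?_, IsGδ.iInter fun i => (hopen i).isGδ⟩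
  obtain ⟨Q, hQ, hGQ⟩ := hG i.1 i.2.1
  rw [show ⇑(G i.1 i.2.1) = fun z : K i.1 => Q z from funext hGQ]
  exact dense_approximable (fun a p q A B h => (hIs a p q A B).mpr ⟨h.1, hV0 h.2⟩) hJ (hK _)
    (hK0 _) hQ (by positivity)

end PadeUniversal

/-- `ℕ → ℂ` carries the product topology. The class is dense and `G_δ`, both for Padé approximants
with degrees at most `(p, q)` and for those with degrees exactly `(p, q)`. -/
theorem proposition4p4
    (J : Set (ℕ × ℕ)) (hJ : PadeUniversal.ConditionH J)
    (K : ℕ → Set ℂ) (hK : ∀ m, IsCompact (K m)) (hK0 : ∀ m, (0 : ℂ) ∉ K m) :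
    (Dense (PadeUniversal.universalClass PadeUniversal.IsPadeApproximant J K) ∧
      IsGδ (PadeUniversal.universalClass PadeUniversal.IsPadeApproximant J K)) ∧
    (Dense (PadeUniversal.universalClass PadeUniversal.IsExactPadeApproximant J K) ∧
      IsGδ (PadeUniversal.universalClass PadeUniversal.IsExactPadeApproximant J K)) := by
  refine ⟨PadeUniversal.dense_and_isGδ_universalClass isOpen_univ (subset_univ _)
    (fun a p q A B => by simp) hJ hK hK0, PadeUniversal.dense_and_isGδ_universalClass
    isOpen_compl_singleton subset_rfl (fun a p q A B => Iff.rfl) hJ hK hK0⟩
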